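/- Let $d\in\mathbb N$, $T>0$ and $\gamma\in\mathbb R$. Let $v_1,v_2:[0,T]\times\mathbb R^d\to\mathbb R^d$ and $\rho_1,\rho_2:[0,T]\times\mathbb R^d\to(0,\infty)$ be jointly continuous, differentiable in the space variable, with jointly continuous spatial derivative. Suppose that $v_i$ generates the probability path with Lebesgue densities $\rho_{i,t}$ ($i=1,2$), that is, there is a random solution of the probability flow ODE $\mathrm dX_t=v_{i,t}(X_t)\,\mathrm dt$ on $[0,T]$ such that $X_t$ has density $\rho_{i,t}$ for every $t\in[0,T]$; and suppose that both paths start from the same density, $\rho_{1,0}=\rho_{2,0}=\rho_0$. Let $\psi$ be the flow on $[0,T]$ of the mixed field $v^{(\gamma)}_t=\gamma v_{1,t}+(1-\gamma)v_{2,t}$: for all $x\in\mathbb R^d$ and $t\in[0,T]$, $\frac{\mathrm d}{\mathrm dt}\psi_t(x)=v^{(\gamma)}_t(\psi_t(x))$ and $\psi_0(x)=x$, and each $\psi_t$ maps $\mathbb R^d$ onto $\mathbb R^d$ (no trajectory comes in from infinity). Put $$w_t(x)=\gamma(\gamma-1)\int_0^t\big\langle v_{1,s}(\psi_s(x))-v_{2,s}(\psi_s(x)),\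 \nabla\log\rho_{1,s}(\psi_s(x))-\nabla\log\rho_{2,s}(\psi_s(x))\big\rangle\,\mathrm ds .$$ Let $t\in[0,T]$ be such that $Z_t=\int\rho_{1,t}^{\gamma}\rho_{2,t}^{1-\gamma}\,\mathrm dx<\infty$, and let $\rho^{(\gamma)}_t$ be the measure with density $\rho_{1,t}^{\gamma}\rho_{2,t}^{1-\gamma}/Z_t$. Then $\rho^{(\gamma)}_t$ is a probability measure, $0<\int e^{w_t}\,\mathrm d\rho_0<\infty$, and for every $\rho^{(\gamma)}_t$-integrable function $\varphi:\mathbb R^d\to\mathbb R$ (in particular for every bounded measurable $\varphi$) the function $e^{w_t}\,\varphi\circ\psi_t$ is $\rho_0$-integrable and $$\int\varphi\,\mathrm d\rho^{(\gamma)}_t=\frac{\int e^{w_t(x)}\varphi(\psi_t(x))\,\mathrm d\rho_0(x)}{\int e^{w_t(x)}\,\mathrm d\rho_0(x)} .$$ -/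

import Mathlib

open MeasureTheory ProbabilityTheory Set

noncomputable section

namespace FlowGuidance

/-- The space `ℝ^d` with its Euclidean norm and inner product. -/
abbrev E (d : ℕ) : Type := EuclideanSpace ℝ (Fin d)

/-- The measure on `ℝ^d` with Lebesgue density `f` (used for `f ≥ 0`). -/
def densityMeasure {d : ℕ} (f : E d → ℝ) : Measure (E d) :=
  volume.withDensity (fun x => ENNReal.ofReal (f x))

/-- `f : [0,T] × ℝ^d → F` is jointly continuous, differentiable in the space variable, and its
spatial derivative is jointly continuous. -/
structure IsC1InSpace {d : ℕ} {F : Type*} [NormedAddCommGroup F] [NormedSpace ℝ F]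
    (T : ℝ) (f : ℝ → E d → F) : Prop where
  continuousOn : ContinuousOn (fun p : ℝ × E d => f p.1 p.2) (Icc 0 T ×ˢ univ)
  differentiable : ∀ t ∈ Icc (0 : ℝ) T, Differentiable ℝ (f t)
  continuousOn_fderiv :
    ContinuousOn (fun p : ℝ × E d => fderiv ℝ (f p.1) p.2) (Icc 0 T ×ˢ univ)

/-- The velocity field `v` generates on `[0,T]` the probability path with Lebesgue densities
`ρ t`: there is a random solution of the probability flow ODE `dX_t = v_t(X_t) dt` such that `X_t`
has law `ρ t` for every `t ∈ [0,T]`. -/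
def Generates {d : ℕ} (T : ℝ) (v : ℝ → E d → E d) (ρ : ℝ → E d → ℝ) : Prop :=
  ∃ (Ω : Type) (_ : MeasurableSpace Ω) (P : Measure Ω) (X : ℝ → Ω → E d),
    IsProbabilityMeasure P ∧
    (∀ᵐ ω ∂P, IsIntegralCurveOn (fun t => X t ω) v (Icc 0 T)) ∧
    ∀ t ∈ Icc (0 : ℝ) T, HasLaw (X t) (densityMeasure (ρ t)) P

/-- `ψ` is the flow of `v` on `[0,T]`: `t ↦ ψ t x` solves the ODE with initial value `x`, and every
point of `ℝ^d` is reached at every time, so that no trajectory comes in from infinity. -/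
structure IsFlow {d : ℕ} (T : ℝ) (v : ℝ → E d → E d) (ψ : ℝ → E d → E d) : Prop where
  initial : ∀ x, ψ 0 x = x
  ode : ∀ x, IsIntegralCurveOn (fun t => ψ t x) v (Icc 0 T)
  surjective : ∀ t ∈ Icc (0 : ℝ) T, Function.Surjective (ψ t)

/-- The mixed velocity field `γ v₁ + (1 - γ) v₂`. -/
def mixedField {d : ℕ} (γ : ℝ) (v₁ v₂ : ℝ → E d → E d) : ℝ → E d → E d :=
  fun t x => γ • v₁ t x + (1 - γ) • v₂ t x

/-- The log-weight `w_t(x)` accumulated along the trajectory `s ↦ ψ s x`. -/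
def weight {d : ℕ} (γ : ℝ) (v₁ v₂ : ℝ → E d → E d) (ρ₁ ρ₂ : ℝ → E d → ℝ)
    (ψ : ℝ → E d → E d) (t : ℝ) (x : E d) : ℝ :=
  γ * (γ - 1) * ∫ s in (0 : ℝ)..t,
    inner ℝ (v₁ s (ψ s x) - v₂ s (ψ s x))
      (gradient (fun y => Real.log (ρ₁ s y)) (ψ s x)
        - gradient (fun y => Real.log (ρ₂ s y)) (ψ s x))

/-- The unnormalized geometric mixture `ρ₁^γ ρ₂^(1-γ)` at time `t`. -/
def unnormalizedMixture {d : ℕ} (γ : ℝ) (ρ₁ ρ₂ : ℝ → E d → ℝ) (t : ℝ) (x : E d) : ℝ :=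
  ρ₁ t x ^ γ * ρ₂ t x ^ (1 - γ)

/-- The normalizing constant of the geometric mixture at time `t`. -/
def mixtureConst {d : ℕ} (γ : ℝ) (ρ₁ ρ₂ : ℝ → E d → ℝ) (t : ℝ) : ℝ :=
  ∫ x, unnormalizedMixture γ ρ₁ ρ₂ t x

/-- The normalized geometric mixture at time `t`, as a measure on `ℝ^d`. -/
def geometricMixture {d : ℕ} (γ : ℝ) (ρ₁ ρ₂ : ℝ → E d → ℝ) (t : ℝ) : Measure (E d) :=
  densityMeasure (fun x => unnormalizedMixture γ ρ₁ ρ₂ t x / mixtureConst γ ρ₁ ρ₂ t)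

end FlowGuidance

end

/-! Along a trajectory of the mixed field u = γ v₁ + (1 - γ) v₂ the continuity equation ∂ρᵢ =
-div(ρᵢ vᵢ) gives (log ρᵢ)' = -div vᵢ + ⟨∇log ρᵢ, u - vᵢ⟩. Here u - v₁ = (γ - 1)(v₁ - v₂) and u - v₂
= γ(v₁ - v₂). Hence γ log ρ₁ + (1 - γ) log ρ₂ has derivative -div u plus exactly the integrand of w,
factor γ(γ - 1) included. By Liouville's formula det Dψ grows at relative rate div u, which cancels
the remaining divergence. So, with q = ρ₁^γ ρ₂^(1-γ), one gets q_t(ψ_t(x)) det Dψ_t(x) = ρ₀(x)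
exp(w_t(x)) (`unnormalizedMixture_flow_mul_det_of_c1Space`).

Since ψ_t is a bijection, the change of variables y = ψ_t(x) turns ∫ q_t φ into ∫ exp(w_t) φ∘ψ_t
dρ₀; the case φ = 1 identifies Z_t with the denominator.

Two analytic inputs are needed. Differentiability of the flow comes from the variational equation
and Grönwall (`exists_hasFDerivAt_flow`). The pointwise continuity equation is extracted from the
random solution by testing against bump functions (`Generates.eq_sub_integral_divergence`). -/

noncomputable section

namespace FlowGuidance

open scoped NNReal Topology ContDiff

/-! ### Global solutions of linear differential equations -/

section LinearODE

variable {F : Type*} [NormedAddCommGroup F] [NormedSpace ℝ F]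

/-- The radial retraction onto the closed ball of radius `R`. -/
def radialRetraction (R : ℝ) (x : F) : F := (R / max R ‖x‖) • x

lemma radialRetraction_of_norm_le {R : ℝ} (hR : 0 < R) {x : F} (hx : ‖x‖ ≤ R) :
    radialRetraction R x = x := by
  simp [radialRetraction, max_eq_left hx, hR.ne']

lemma norm_radialRetraction_le_norm {R : ℝ} (hR : 0 < R) (x : F) :
    ‖radialRetraction R x‖ ≤ ‖x‖ := by
  have h : 0 < max R ‖x‖ := lt_max_of_lt_left hR
  rw [radialRetraction, norm_smul, Real.norm_of_nonneg (by positivity)]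
  exact mul_le_of_le_one_left (norm_nonneg _) ((div_le_one h).2 (le_max_left _ _))

lemma norm_radialRetraction_le {R : ℝ} (hR : 0 < R) (x : F) :
    ‖radialRetraction R x‖ ≤ R := by
  have h : 0 < max R ‖x‖ := lt_max_of_lt_left hR
  rw [radialRetraction, norm_smul, Real.norm_of_nonneg (by positivity), div_mul_eq_mul_div,
    div_le_iff₀ h]
  exact mul_le_mul_of_nonneg_left (le_max_right _ _) hR.le

/-- The displacement and the change of the scaling factor each contribute at most ‖x - y‖. The
constant is crude, but valid in any normed space. -/
lemma norm_radialRetraction_sub_le {R : ℝ} (hR : 0 < R) (x y : F) :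
    ‖radialRetraction R x - radialRetraction R y‖ ≤ 2 * ‖x - y‖ := by
  set a := max R ‖x‖ with ha
  set b := max R ‖y‖ with hb
  have ha0 : 0 < a := lt_max_of_lt_left hR
  have hb0 : 0 < b := lt_max_of_lt_left hR
  have hab : |b - a| ≤ ‖x - y‖ := by
    calc |b - a| ≤ max |R - R| |‖y‖ - ‖x‖| := abs_max_sub_max_le_max _ _ _ _
      _ = |‖y‖ - ‖x‖| := by simp
      _ ≤ ‖y - x‖ := abs_norm_sub_norm_le _ _
      _ = ‖x - y‖ := norm_sub_rev _ _
  have key : radialRetraction R x - radialRetraction R y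
      = (R / a) • (x - y) + ((R / a) * ((b - a) / b)) • y := by
    simp only [radialRetraction, ← ha, ← hb]
    rw [smul_sub, sub_add, ← sub_smul]
    congr 2
    field_simp
    ring
  have h1 : R / a ≤ 1 := (div_le_one ha0).2 (le_max_left _ _)
  have h2 : ‖y‖ / b ≤ 1 := (div_le_one hb0).2 (le_max_right _ _)
  have h3 : ‖((R / a) * ((b - a) / b)) • y‖ = (R / a) * |b - a| * (‖y‖ / b) := by
    rw [norm_smul, Real.norm_eq_abs, abs_mul, abs_div (b - a), abs_of_pos hb0,
      abs_of_pos (by positivity)]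
    ring
  have h4 : ‖(R / a) • (x - y)‖ = (R / a) * ‖x - y‖ := by
    rw [norm_smul, Real.norm_of_nonneg (by positivity)]
  calc _ ≤ (R / a) * ‖x - y‖ + (R / a) * |b - a| * (‖y‖ / b) := by
        rw [key, ← h3, ← h4]; exact norm_add_le _ _
    _ ≤ 1 * ‖x - y‖ + 1 * ‖x - y‖ * 1 := by gcongr
    _ = _ := by ring

/-- A linear ordinary differential equation with continuous coefficients has a global solution. -/
theorem exists_hasDerivWithinAt_linear [CompleteSpace F] {T : ℝ} (hT : 0 ≤ T)
    {B : ℝ → F →L[ℝ] F} (hB : ContinuousOn B (Icc 0 T)) (x₀ : F) :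
    ∃ y : ℝ → F, y 0 = x₀ ∧ ∀ t ∈ Icc 0 T, HasDerivWithinAt y (B t (y t)) (Icc 0 T) t := by
  obtain ⟨M, hM⟩ := (isCompact_Icc (a := (0 : ℝ)) (b := T)).exists_bound_of_continuousOn hB
  have hM0 : 0 ≤ M := (norm_nonneg _).trans (hM 0 ⟨le_rfl, hT⟩)
  -- The Grönwall a priori bound, plus 1 to make it positive. Truncating the equation at this radius
  -- makes it bounded by M R, so Picard–Lindelöf covers all of [0, T] at once.
  set R : ℝ := ‖x₀‖ * Real.exp (M * T) + 1 with hR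
  have hR0 : 0 < R := by positivity
  have hpl : IsPicardLindelof (fun t x => B t (radialRetraction R x))
      (⟨0, le_rfl, hT⟩ : Icc (0 : ℝ) T) x₀
      (M * R * T).toNNReal 0 (M * R).toNNReal (M * 2).toNNReal := by
    refine ⟨fun t ht => LipschitzWith.lipschitzOnWith ?_, fun x _ => ?_, fun t ht x _ => ?_, ?_⟩
    · refine LipschitzWith.of_dist_le_mul fun x y => ?_
      rw [dist_eq_norm, dist_eq_norm, ← map_sub]
      calc _ ≤ M * (2 * ‖x - y‖) :=
            (B t).le_of_opNorm_le_of_le (hM t ht) (norm_radialRetraction_sub_le hR0 x y)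
        _ = _ := by rw [Real.coe_toNNReal _ (by positivity), mul_assoc]
    · exact hB.clm_apply continuousOn_const
    · rw [Real.coe_toNNReal _ (by positivity)]
      exact (B t).le_of_opNorm_le_of_le (hM t ht) (norm_radialRetraction_le hR0 x)
    · rw [Real.coe_toNNReal _ (by positivity), Real.coe_toNNReal _ (by positivity)]
      simp [max_eq_left hT]
  obtain ⟨y, hy0, hy⟩ := hpl.exists_eq_forall_mem_Icc_hasDerivWithinAt₀
  simp only at hy0
  -- The retraction does not increase norms, so the truncated equation obeys the linear growth
  -- bound; its solution therefore never leaves the ball where the truncation is inactive.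
  have hbound : ∀ t ∈ Icc 0 T, ‖y t‖ ≤ gronwallBound ‖x₀‖ M 0 (t - 0) := by
    refine norm_le_gronwallBound_of_norm_deriv_right_le
      (fun t ht => (hy t ht).continuousWithinAt)
      (fun t ht => ?_) (by rw [hy0]) (fun t ht => ?_)
      (f' := fun t => B t (radialRetraction R (y t)))
    · exact (hy t (Ico_subset_Icc_self ht)).mono_of_mem_nhdsWithin (Icc_mem_nhdsGE_of_mem ht)
    · rw [add_zero]
      exact (B t).le_of_opNorm_le_of_le (hM t (Ico_subset_Icc_self ht))
        (norm_radialRetraction_le_norm hR0 _)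
  refine ⟨y, hy0, fun t ht => ?_⟩
  have h := hy t ht
  have hle : ‖y t‖ ≤ R := by
    refine (hbound t ht).trans ?_
    rw [gronwallBound_ε0, sub_zero, hR]
    have : Real.exp (M * t) ≤ Real.exp (M * T) := by gcongr; exact ht.2
    nlinarith [norm_nonneg x₀]
  rwa [radialRetraction_of_norm_le hR0 hle] at h

end LinearODE

/-- `f : ℝ × E → F` is jointly continuous, differentiable in the space variable, and its spatial
derivative is jointly continuous. -/
structure C1Space {E F : Type*} [NormedAddCommGroup E] [NormedSpace ℝ E] [NormedAddCommGroup F]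
    [NormedSpace ℝ F] (f : ℝ → E → F) : Prop where
  continuous : Continuous fun p : ℝ × E => f p.1 p.2
  differentiable : ∀ t, Differentiable ℝ (f t)
  continuous_fderiv : Continuous fun p : ℝ × E => fderiv ℝ (f p.1) p.2

/-! ### Injectivity and differentiability of the flow -/

section Flow

variable {V : Type*} [NormedAddCommGroup V] [NormedSpace ℝ V] {v : ℝ → V → V} {T : ℝ}

lemma _root_.IsIntegralCurveOn.hasDerivWithinAt_Ici {y : ℝ → V} (hy : IsIntegralCurveOn y v (Icc 0 T))
    {t : ℝ} (ht : t ∈ Ico 0 T) : HasDerivWithinAt y (v t (y t)) (Ici t) t :=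
  (hy t (Ico_subset_Icc_self ht)).mono_of_mem_nhdsWithin (Icc_mem_nhdsGE_of_mem ht)

lemma _root_.IsIntegralCurveOn.exists_norm_le {y : ℝ → V} (hy : IsIntegralCurveOn y v (Icc 0 T)) :
    ∃ R : ℝ, ∀ s ∈ Icc 0 T, ‖y s‖ ≤ R :=
  isCompact_Icc.exists_bound_of_continuousOn hy.continuousOn

variable [FiniteDimensional ℝ V]

lemma C1Space.exists_fderiv_bound (hv : C1Space v) (T R : ℝ) :
    ∃ K : ℝ≥0, ∀ s ∈ Icc 0 T, ∀ z ∈ Metric.closedBall (0 : V) R, ‖fderiv ℝ (v s) z‖ ≤ K := by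
  have := FiniteDimensional.proper ℝ V
  obtain ⟨M, hM⟩ := ((isCompact_Icc (a := (0 : ℝ)) (b := T)).prod
    (isCompact_closedBall (0 : V) R)).exists_bound_of_continuousOn
    hv.continuous_fderiv.continuousOn
  exact ⟨M.toNNReal, fun s hs z hz => (hM (s, z) ⟨hs, hz⟩).trans (Real.le_coe_toNNReal M)⟩

lemma C1Space.exists_lipschitzOnWith (hv : C1Space v) (T R : ℝ) :
    ∃ K : ℝ≥0, ∀ s ∈ Icc 0 T, LipschitzOnWith K (v s) (Metric.closedBall (0 : V) R) := by
  obtain ⟨K, hK⟩ := hv.exists_fderiv_bound T R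
  exact ⟨K, fun s hs => (convex_closedBall _ _).lipschitzOnWith_of_nnnorm_fderiv_le
    (fun z _ => hv.differentiable s z) (fun z hz => hK s hs z hz)⟩

/-- Trajectories that meet at some time start from the same point. -/
lemma _root_.IsIntegralCurveOn.eq_initial_of_eq (hv : C1Space v) {y z : ℝ → V}
    (hy : IsIntegralCurveOn y v (Icc 0 T)) (hz : IsIntegralCurveOn z v (Icc 0 T))
    {t : ℝ} (ht : t ∈ Icc 0 T) (h : y t = z t) : y 0 = z 0 := by
  obtain ⟨R₁, h₁⟩ := hy.exists_norm_le
  obtain ⟨R₂, h₂⟩ := hz.exists_norm_le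
  obtain ⟨K, hK⟩ := hv.exists_lipschitzOnWith T (max R₁ R₂)
  have hsub : Icc 0 t ⊆ Icc 0 T := Icc_subset_Icc_right ht.2
  -- Uniqueness run backwards from the meeting time, inside a ball containing both trajectories.
  have key := ODE_solution_unique_of_mem_Icc_left (v := v) (a := 0) (b := t) (K := K)
    (s := fun _ => Metric.closedBall 0 (max R₁ R₂)) (f := y) (g := z)
    (fun s hs => hK s (hsub (Ioc_subset_Icc_self hs)))
    (hy.continuousOn.mono hsub)
    (fun s hs => (hy s (hsub (Ioc_subset_Icc_self hs))).mono_of_mem_nhdsWithin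
      (Filter.mem_of_superset (Icc_mem_nhdsLE_of_mem hs) hsub))
    (fun s hs => mem_closedBall_zero_iff.2
      ((h₁ s (hsub (Ioc_subset_Icc_self hs))).trans (le_max_left _ _)))
    (hz.continuousOn.mono hsub)
    (fun s hs => (hz s (hsub (Ioc_subset_Icc_self hs))).mono_of_mem_nhdsWithin
      (Filter.mem_of_superset (Icc_mem_nhdsLE_of_mem hs) hsub))
    (fun s hs => mem_closedBall_zero_iff.2
      ((h₂ s (hsub (Ioc_subset_Icc_self hs))).trans (le_max_right _ _))) h
  exact key ⟨le_rfl, ht.1⟩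

/-- Trajectories depend on the initial value in a locally Lipschitz way, uniformly in time. -/
lemma _root_.IsIntegralCurveOn.exists_dist_le (hv : C1Space v) {y : ℝ → V}
    (hy : IsIntegralCurveOn y v (Icc 0 T)) :
    ∃ δ > 0, ∃ C > 0, ∀ z : ℝ → V, IsIntegralCurveOn z v (Icc 0 T) → dist (z 0) (y 0) < δ →
      ∀ s ∈ Icc 0 T, dist (z s) (y s) ≤ C * dist (z 0) (y 0) ∧ dist (z s) (y s) < 1 := by
  obtain ⟨R, hR⟩ := hy.exists_norm_le
  obtain ⟨K, hK⟩ := hv.exists_lipschitzOnWith T (R + 1)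
  set C := Real.exp (K * T) with hC
  have hC0 : 0 < C := Real.exp_pos _
  -- With δ = 1/C the Grönwall estimate is strictly below 1, so it can close the bootstrap that
  -- keeps z in the unit tube around y.
  refine ⟨C⁻¹, by positivity, C, hC0, fun z hz hδ => ?_⟩
  have hlt : C * dist (z 0) (y 0) < 1 := by
    calc _ < C * C⁻¹ := by gcongr
      _ = 1 := mul_inv_cancel₀ hC0.ne'
  have hcont : ContinuousOn (fun s => dist (z s) (y s)) (Icc 0 T) :=
    continuous_dist.comp_continuousOn
      (hz.continuousOn.prodMk hy.continuousOn)
  have step : ∀ b ∈ Icc 0 T, (∀ s ∈ Ico 0 b, dist (z s) (y s) < 1) →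
      dist (z b) (y b) ≤ C * dist (z 0) (y 0) := by
    intro b hb hs
    have hsub : Icc 0 b ⊆ Icc 0 T := Icc_subset_Icc_right hb.2
    have hsub' : Ico 0 b ⊆ Ico 0 T := Ico_subset_Ico_right hb.2
    have hyR : ∀ s ∈ Ico 0 b, ‖y s‖ ≤ R := fun s h => hR s (hsub (Ico_subset_Icc_self h))
    have := dist_le_of_trajectories_ODE_of_mem (v := v) (a := 0) (b := b) (K := K)
      (s := fun _ => Metric.closedBall 0 (R + 1)) (f := z) (g := y)
      (fun s hs => hK s (hsub (Ico_subset_Icc_self hs)))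
      (hz.continuousOn.mono hsub)
      (fun s hs => hz.hasDerivWithinAt_Ici (hsub' hs))
      (fun s h => by
        rw [mem_closedBall_zero_iff]
        have h1 := hs s h
        rw [dist_eq_norm] at h1
        calc ‖z s‖ = ‖y s + (z s - y s)‖ := by congr 1; abel
          _ ≤ ‖y s‖ + ‖z s - y s‖ := norm_add_le _ _
          _ ≤ R + 1 := add_le_add (hyR s h) h1.le)
      (hy.continuousOn.mono hsub)
      (fun s hs => hy.hasDerivWithinAt_Ici (hsub' hs))
      (fun s h => by
        rw [mem_closedBall_zero_iff]
        linarith [hyR s h]) le_rfl b ⟨hb.1, le_rfl⟩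
    refine this.trans ?_
    rw [mul_comm, hC, sub_zero]
    gcongr
    exact hb.2
  -- At a first exit time b the distance is at least 1, while Grönwall on [0, b] makes it less than
  -- 1.
  have tube : ∀ s ∈ Icc 0 T, dist (z s) (y s) < 1 := by
    by_contra! hcon
    have hcl : IsCompact (Icc 0 T ∩ (fun s => dist (z s) (y s)) ⁻¹' Ici 1) :=
      isCompact_Icc.of_isClosed_subset (hcont.preimage_isClosed_of_isClosed isClosed_Icc isClosed_Ici)
        inter_subset_left
    obtain ⟨b, hb, hmin⟩ := hcl.exists_isLeast (by
      obtain ⟨s, hs, h1⟩ := hcon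
      exact ⟨s, hs, h1⟩)
    have h1 := step b hb.1 (fun s hs => by
      by_contra! h
      exact absurd (hmin ⟨⟨hs.1, hs.2.le.trans hb.1.2⟩, h⟩) (not_le.2 hs.2))
    exact absurd (hb.2 : (1 : ℝ) ≤ dist (z b) (y b)) (not_le.2 (h1.trans_lt hlt))
  exact fun s hs => ⟨step s hs fun r hr => tube r ⟨hr.1, hr.2.le.trans hs.2⟩, tube s hs⟩

/-- Differentiable dependence of the flow on the initial value: the derivative solves the
variational equation. -/
theorem exists_hasFDerivAt_flow (hv : C1Space v) (hT : 0 ≤ T) {ψ : ℝ → V → V}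
    (h0 : ∀ x, ψ 0 x = x) (hψ : ∀ x, IsIntegralCurveOn (fun t => ψ t x) v (Icc 0 T)) (x : V) :
    ∃ J : ℝ → V →L[ℝ] V, J 0 = ContinuousLinearMap.id ℝ V ∧
      (∀ t ∈ Icc 0 T, HasDerivWithinAt J ((fderiv ℝ (v t) (ψ t x)).comp (J t)) (Icc 0 T) t) ∧
      ∀ t ∈ Icc 0 T, HasFDerivAt (ψ t) (J t) x := by
  have := FiniteDimensional.proper ℝ V
  have hψc : ContinuousOn (fun t => ψ t x) (Icc 0 T) := (hψ x).continuousOn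
  have hAc : ContinuousOn (fun t => fderiv ℝ (v t) (ψ t x)) (Icc 0 T) :=
    hv.continuous_fderiv.comp_continuousOn (continuousOn_id.prodMk hψc)
  obtain ⟨J, hJ0, hJ⟩ := exists_hasDerivWithinAt_linear (F := V →L[ℝ] V) hT
    -- The variational equation is linear on the space of endomorphisms: the coefficient acts by
    -- left composition.
    (B := fun t => ContinuousLinearMap.compL ℝ V V V (fderiv ℝ (v t) (ψ t x)))
    ((ContinuousLinearMap.compL ℝ V V V).continuous.comp_continuousOn hAc)
    (ContinuousLinearMap.id ℝ V)
  refine ⟨J, hJ0, hJ, fun t ht => ?_⟩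
  obtain ⟨δ, hδ, C, hC, htube⟩ := (hψ x).exists_dist_le hv
  obtain ⟨R, hR⟩ := (hψ x).exists_norm_le
  obtain ⟨K, hK⟩ := hv.exists_fderiv_bound T R
  have huc := (((isCompact_Icc (a := (0 : ℝ)) (b := T)).prod
    (isCompact_closedBall (0 : V) (R + 1)))).uniformContinuousOn_of_continuous
    hv.continuous_fderiv.continuousOn
  rw [Metric.uniformContinuousOn_iff] at huc
  set G := gronwallBound 0 K 1 T with hG
  have hG0 : 0 ≤ G := by
    have := gronwallBound_mono (δ := 0) (ε := 1) (K := K) le_rfl zero_le_one K.coe_nonneg hT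
    rwa [gronwallBound_x0] at this
  have hGle : ∀ ε, 0 ≤ ε → ∀ s ∈ Icc 0 T, gronwallBound 0 K ε s ≤ ε * G := by
    intro ε hε s hs
    refine (gronwallBound_mono le_rfl hε K.coe_nonneg hs.2).trans_eq ?_
    rw [hG]
    by_cases hK0 : (K : ℝ) = 0
    · simp [gronwallBound, hK0]
    · rw [gronwallBound_of_K_ne_0 (ε := ε) hK0, gronwallBound_of_K_ne_0 (ε := 1) hK0]; ring
  rw [hasFDerivAt_iff_isLittleO, Asymptotics.isLittleO_iff]
  intro c hc
  -- Chosen so that η C G ≤ c, the final Grönwall estimate; the summand 1 avoids dividing by zero.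
  set η : ℝ := c / (C * (G + 1)) with hη
  have hη0 : 0 < η := by positivity
  obtain ⟨δ', hδ', huc'⟩ := huc η hη0
  have hρ : 0 < min δ (δ' / C) := lt_min hδ (by positivity)
  filter_upwards [Metric.ball_mem_nhds x hρ] with z hz
  have hzδ : dist (ψ 0 z) (ψ 0 x) < δ := by
    rw [h0, h0]; exact (Metric.mem_ball.1 hz).trans_le (min_le_left _ _)
  have hzδ' : C * dist z x < δ' := by
    have := (Metric.mem_ball.1 hz).trans_le (min_le_right _ _)
    rwa [lt_div_iff₀' hC] at this
  have ht1 := htube _ (hψ z) hzδ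
  simp only [h0] at ht1
  -- The linearization error starts at 0 and satisfies ‖e'‖ ≤ K ‖e‖ + η C ‖z - x‖: the last term is
  -- the Taylor remainder of v, small by uniform continuity of its derivative.
  set e : ℝ → V := fun s => ψ s z - ψ s x - J s (z - x) with he
  have hed : ∀ s ∈ Icc 0 T, HasDerivWithinAt e (v s (ψ s z) - v s (ψ s x)
      - ((fderiv ℝ (v s) (ψ s x)).comp (J s)) (z - x)) (Icc 0 T) s := fun s hs =>
    ((hψ z s hs).sub (hψ x s hs)).sub
      ((hJ s hs).clm_apply (hasDerivWithinAt_const s (Icc 0 T) (z - x)) |>.congr_deriv (by simp))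
  have hlin : ∀ s ∈ Icc 0 T, ‖v s (ψ s z) - v s (ψ s x)
      - fderiv ℝ (v s) (ψ s x) (ψ s z - ψ s x)‖ ≤ η * (C * dist z x) := by
    intro s hs
    have hd := ht1 s hs
    set S := Metric.closedBall (ψ s x) (dist (ψ s z) (ψ s x)) with hS
    have hxR := hR s hs
    have hmem : ∀ u ∈ S, ‖fderiv ℝ (v s) u - fderiv ℝ (v s) (ψ s x)‖ ≤ η := by
      intro u hu
      have hu' : dist u (ψ s x) ≤ dist (ψ s z) (ψ s x) := hu
      have h := huc' (s, u) ⟨hs, ?_⟩ (s, ψ s x) ⟨hs, ?_⟩ ?_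
      · rw [dist_eq_norm] at h; exact h.le
      · rw [mem_closedBall_zero_iff]
        rw [dist_eq_norm] at hu'
        calc ‖u‖ = ‖ψ s x + (u - ψ s x)‖ := by congr 1; abel
          _ ≤ ‖ψ s x‖ + ‖u - ψ s x‖ := norm_add_le _ _
          _ ≤ R + 1 := add_le_add hxR (hu'.trans hd.2.le)
      · rw [mem_closedBall_zero_iff]; linarith
      · rw [Prod.dist_eq, dist_self, max_eq_right dist_nonneg]
        exact (hu'.trans hd.1).trans_lt hzδ'
    have := (convex_closedBall (ψ s x) (dist (ψ s z) (ψ s x))).norm_image_sub_le_of_norm_fderiv_le'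
      (𝕜 := ℝ) (f := v s) (fun u _ => hv.differentiable s u) hmem
      (Metric.mem_closedBall_self dist_nonneg) (Metric.mem_closedBall.2 le_rfl)
    refine this.trans ?_
    rw [← dist_eq_norm]
    exact mul_le_mul_of_nonneg_left hd.1 hη0.le
  have hgr := norm_le_gronwallBound_of_norm_deriv_right_le (f := e)
    (f' := fun s => v s (ψ s z) - v s (ψ s x) - ((fderiv ℝ (v s) (ψ s x)).comp (J s)) (z - x))
    (δ := 0) (K := K) (ε := η * (C * dist z x)) (a := 0) (b := T)
    (fun s hs => (hed s hs).continuousWithinAt)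
    (fun s hs => (hed s (Ico_subset_Icc_self hs)).mono_of_mem_nhdsWithin
      (Icc_mem_nhdsGE_of_mem hs))
    (by simp [he, h0, hJ0])
    (fun s hs => by
      have hs' := Ico_subset_Icc_self hs
      have heq : v s (ψ s z) - v s (ψ s x) - ((fderiv ℝ (v s) (ψ s x)).comp (J s)) (z - x)
          = fderiv ℝ (v s) (ψ s x) (e s)
            + (v s (ψ s z) - v s (ψ s x) - fderiv ℝ (v s) (ψ s x) (ψ s z - ψ s x)) := by
        simp only [he, map_sub, ContinuousLinearMap.comp_apply]; abel
      rw [heq]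
      refine (norm_add_le _ _).trans (add_le_add ?_ (hlin s hs'))
      exact (fderiv ℝ (v s) (ψ s x)).le_of_opNorm_le
        (hK s hs' _ (mem_closedBall_zero_iff.2 (hR s hs'))) _) t ht
  have hnn : 0 ≤ η * (C * dist z x) := by positivity
  rw [sub_zero] at hgr
  refine (hgr.trans (hGle _ hnn t ht)).trans ?_
  rw [← dist_eq_norm]
  have : η * (C * (G + 1)) = c := by rw [hη]; field_simp
  calc η * (C * dist z x) * G ≤ η * (C * dist z x) * (G + 1) := by gcongr; linarith
    _ = (η * (C * (G + 1))) * dist z x := by ring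
    _ = c * dist z x := by rw [this]

end Flow

/-! ### Liouville's formula -/

section Det

/-- The determinant of a square matrix as a continuous multilinear function of its rows. -/
def detRowContinuousMultilinear (n : ℕ) :
    ContinuousMultilinearMap ℝ (fun _ : Fin n => Fin n → ℝ) ℝ where
  toMultilinearMap := Matrix.detRowAlternating.toMultilinearMap
  cont := (continuous_id (X := Matrix (Fin n) (Fin n) ℝ)).matrix_det

/-- Liouville's formula for matrices. -/
lemma hasDerivWithinAt_matrix_det {n : ℕ} {M : ℝ → Matrix (Fin n) (Fin n) ℝ}
    {A : Matrix (Fin n) (Fin n) ℝ} {s : Set ℝ} {t : ℝ}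
    (hM : ∀ i j, HasDerivWithinAt (fun t => M t i j) ((A * M t) i j) s t) :
    HasDerivWithinAt (fun t => (M t).det) (A.trace * (M t).det) s t := by
  have hM' : HasDerivWithinAt (fun t => (M t : Fin n → Fin n → ℝ)) (A * M t : Fin n → Fin n → ℝ)
      s t := hasDerivWithinAt_pi.2 fun i => hasDerivWithinAt_pi.2 fun j => hM i j
  have h := ((detRowContinuousMultilinear n).hasFDerivAt (M t)).comp_hasDerivWithinAt t hM'
  refine h.congr_deriv ?_
  refine (ContinuousMultilinearMap.linearDeriv_apply _ _ _).trans ?_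
  rw [Matrix.trace, Finset.sum_mul]
  refine Finset.sum_congr rfl fun i _ => ?_
  -- In the determinant with row i replaced by this combination, only the k = i term survives;
  -- summing over i gives the trace.
  have hrow : (A * M t) i = ∑ k, A i k • M t k := by
    ext j; simp [Matrix.mul_apply]
  rw [hrow]
  exact Matrix.det_updateRow_sum (M t) i (A i)

variable {V : Type*} [NormedAddCommGroup V] [NormedSpace ℝ V] [FiniteDimensional ℝ V]

/-- The trace of a continuous linear endomorphism, as a continuous linear map. -/
def traceCLM (V : Type*) [NormedAddCommGroup V] [NormedSpace ℝ V] [FiniteDimensional ℝ V] :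
    (V →L[ℝ] V) →L[ℝ] ℝ :=
  LinearMap.toContinuousLinearMap
    ((LinearMap.trace ℝ V).comp (ContinuousLinearMap.coeLM ℝ))

lemma traceCLM_apply (A : V →L[ℝ] V) : traceCLM V A = LinearMap.trace ℝ V (A : V →ₗ[ℝ] V) := rfl

/-- Liouville's formula for the determinant of a solution of a linear equation. -/
lemma hasDerivWithinAt_det {J : ℝ → V →L[ℝ] V} {A : V →L[ℝ] V} {s : Set ℝ} {t : ℝ}
    (hJ : HasDerivWithinAt J (A.comp (J t)) s t) :
    HasDerivWithinAt (fun t => (J t).det) (traceCLM V A * (J t).det) s t := by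
  let b := Module.finBasis ℝ V
  have hdet : ∀ L : V →L[ℝ] V, L.det = (LinearMap.toMatrix b b (L : V →ₗ[ℝ] V)).det := fun L =>
    (LinearMap.det_toMatrix b _).symm
  simp only [hdet]
  rw [traceCLM_apply, LinearMap.trace_eq_matrix_trace ℝ b]
  refine hasDerivWithinAt_matrix_det fun i j => ?_
  rw [← LinearMap.toMatrix_mul]
  simp only [LinearMap.toMatrix_apply]
  exact (LinearMap.toContinuousLinearMap (b.coord i)).hasFDerivAt.comp_hasDerivWithinAt t
    (hJ.clm_apply (hasDerivWithinAt_const t s (b j)) |>.congr_deriv (by simp))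

end Det

/-! ### Divergence and integration by parts -/

section Divergence

variable {V : Type*} [NormedAddCommGroup V] [NormedSpace ℝ V] [FiniteDimensional ℝ V]

/-- The divergence of a vector field. -/
def divergence (u : V → V) (x : V) : ℝ := traceCLM V (fderiv ℝ u x)

lemma traceCLM_eq_sum_coord {ι : Type*} [Fintype ι] [DecidableEq ι] (b : Module.Basis ι ℝ V)
    (A : V →L[ℝ] V) : traceCLM V A = ∑ i, b.coord i (A (b i)) := by
  rw [traceCLM_apply, LinearMap.trace_eq_matrix_trace ℝ b, Matrix.trace]
  simp [LinearMap.toMatrix_apply]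

lemma divergence_smul {ρ : V → ℝ} {u : V → V} {x : V} (hρ : DifferentiableAt ℝ ρ x)
    (hu : DifferentiableAt ℝ u x) :
    divergence (fun y => ρ y • u y) x = ρ x * divergence u x + fderiv ℝ ρ x (u x) := by
  have h : traceCLM V ((fderiv ℝ ρ x).smulRight (u x)) = fderiv ℝ ρ x (u x) :=
    LinearMap.trace_smulRight (fderiv ℝ ρ x : V →ₗ[ℝ] ℝ) (u x)
  rw [divergence, fderiv_fun_smul hρ hu, map_add, map_smul, h, smul_eq_mul, divergence]

/-- Integration by parts against a compactly supported test function. -/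
lemma integral_mul_divergence [MeasurableSpace V] [BorelSpace V] (μ : Measure V)
    [μ.IsAddHaarMeasure] {f : V → ℝ} {u : V → V} (hf : ContDiff ℝ 1 f) (hfs : HasCompactSupport f)
    (hu : ContDiff ℝ 1 u) :
    ∫ x, f x * divergence u x ∂μ = - ∫ x, fderiv ℝ f x (u x) ∂μ := by
  classical
  let b := Module.finBasis ℝ V
  let c : Fin (Module.finrank ℝ V) → V →L[ℝ] ℝ := fun i =>
    LinearMap.toContinuousLinearMap (b.coord i)
  have hcu : ∀ i, ContDiff ℝ 1 fun x => c i (u x) := fun i => (c i).contDiff.comp hu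
  have hfd : ∀ i, Continuous fun x => fderiv ℝ f x (b i) := fun i =>
    (hf.continuous_fderiv one_ne_zero).clm_apply continuous_const
  have hcd : ∀ i, Continuous fun x => fderiv ℝ (fun y => c i (u y)) x (b i) := fun i =>
    ((hcu i).continuous_fderiv one_ne_zero).clm_apply continuous_const
  have hfs' : ∀ i, HasCompactSupport fun x => fderiv ℝ f x (b i) := fun i =>
    hfs.fderiv_apply (𝕜 := ℝ) (b i)
  have h1 : ∀ i, Integrable (fun x => f x * fderiv ℝ (fun y => c i (u y)) x (b i)) μ := fun i =>
    (hf.continuous.mul (hcd i)).integrable_of_hasCompactSupport hfs.mul_right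
  have h2 : ∀ i, Integrable (fun x => fderiv ℝ f x (b i) * c i (u x)) μ := fun i =>
    ((hfd i).mul (hcu i).continuous).integrable_of_hasCompactSupport (hfs' i).mul_right
  have e1 : ∀ x, f x * divergence u x
      = ∑ i, f x * fderiv ℝ (fun y => c i (u y)) x (b i) := by
    intro x
    rw [divergence, traceCLM_eq_sum_coord b, Finset.mul_sum]
    refine Finset.sum_congr rfl fun i _ => ?_
    have := ((c i).hasFDerivAt.comp x (hu.differentiable one_ne_zero x).hasFDerivAt).fderiv
    rw [show (fun y => c i (u y)) = (c i) ∘ u from rfl, this]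
    rfl
  have e2 : ∀ x, fderiv ℝ f x (u x) = ∑ i, fderiv ℝ f x (b i) * c i (u x) := by
    intro x
    conv_lhs => rw [← b.sum_repr (u x)]
    rw [map_sum]
    refine Finset.sum_congr rfl fun i _ => ?_
    rw [map_smul, smul_eq_mul, mul_comm]
    rfl
  simp only [e1, e2]
  rw [integral_finsetSum _ fun i _ => h1 i, integral_finsetSum _ fun i _ => h2 i,
    ← Finset.sum_neg_distrib]
  exact Finset.sum_congr rfl fun i _ => integral_mul_fderiv_eq_neg_fderiv_mul_of_integrable
    (h2 i) (h1 i) ((hf.continuous.mul (hcu i).continuous).integrable_of_hasCompactSupport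
      hfs.mul_right) (fun x _ => hf.differentiable one_ne_zero x)
    (fun x _ => (hcu i).differentiable one_ne_zero x)

end Divergence

/-! ### From the random solution to the pointwise continuity equation -/

section ContinuityEquation

lemma C1Space.contDiff {V F : Type*} [NormedAddCommGroup V] [NormedSpace ℝ V]
    [NormedAddCommGroup F] [NormedSpace ℝ F] {f : ℝ → V → F} (hf : C1Space f) (t : ℝ) :
    ContDiff ℝ 1 (f t) :=
  contDiff_one_iff_fderiv.2 ⟨hf.differentiable t,
    hf.continuous_fderiv.comp (continuous_const.prodMk continuous_id)⟩

lemma C1Space.smul {V F : Type*} [NormedAddCommGroup V] [NormedSpace ℝ V]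
    [NormedAddCommGroup F] [NormedSpace ℝ F] {ρ : ℝ → V → ℝ} {f : ℝ → V → F}
    (hρ : C1Space ρ) (hf : C1Space f) : C1Space fun t x => ρ t x • f t x where
  continuous := hρ.continuous.smul hf.continuous
  differentiable t := (hρ.differentiable t).fun_smul (hf.differentiable t)
  continuous_fderiv := by
    have h : (fun p : ℝ × V => fderiv ℝ (fun x => ρ p.1 x • f p.1 x) p.2)
        = fun p => ρ p.1 p.2 • fderiv ℝ (f p.1) p.2
          + (fderiv ℝ (ρ p.1) p.2).smulRight (f p.1 p.2) := by
      funext p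
      exact fderiv_fun_smul (hρ.differentiable _ _) (hf.differentiable _ _)
    rw [h]
    exact (hρ.continuous.smul hf.continuous_fderiv).add
      ((ContinuousLinearMap.smulRightL ℝ V F).continuous₂.comp
        (hρ.continuous_fderiv.prodMk hf.continuous))

lemma C1Space.continuous_divergence {V : Type*} [NormedAddCommGroup V] [NormedSpace ℝ V]
    [FiniteDimensional ℝ V] {u : ℝ → V → V} (hu : C1Space u) :
    Continuous fun p : ℝ × V => divergence (u p.1) p.2 :=
  (traceCLM V).continuous.comp hu.continuous_fderiv

variable {d : ℕ}

lemma integral_densityMeasure {f : E d → ℝ} (hf : Measurable f) (hf0 : ∀ x, 0 ≤ f x)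
    (g : E d → ℝ) : ∫ x, g x ∂(densityMeasure f) = ∫ x, f x * g x := by
  rw [densityMeasure, integral_withDensity_eq_integral_toReal_smul hf.ennreal_ofReal
    (Filter.Eventually.of_forall fun _ => ENNReal.ofReal_lt_top)]
  simp [ENNReal.toReal_ofReal (hf0 _)]

lemma integrable_densityMeasure_iff {f : E d → ℝ} (hf : Measurable f) (hf0 : ∀ x, 0 ≤ f x)
    (g : E d → ℝ) : Integrable g (densityMeasure f) ↔ Integrable fun x => f x * g x := by
  rw [densityMeasure, integrable_withDensity_iff_integrable_smul' hf.ennreal_ofReal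
    (Filter.Eventually.of_forall fun _ => ENNReal.ofReal_lt_top)]
  simp [ENNReal.toReal_ofReal (hf0 _)]

variable {T : ℝ} {v : ℝ → E d → E d} {ρ : ℝ → E d → ℝ}

/-- The continuity equation in weak form, in space, for a generated probability path. -/
lemma Generates.hasDerivAt_integral (hgen : Generates T v ρ) (hv : C1Space v) (hρ : C1Space ρ)
    (hpos : ∀ t ∈ Icc 0 T, ∀ x, 0 < ρ t x) {f : E d → ℝ} (hf : ContDiff ℝ 1 f)
    (hfs : HasCompactSupport f) {t : ℝ} (ht : t ∈ Ioo 0 T) :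
    HasDerivAt (fun s => ∫ x, ρ s x * f x) (∫ x, ρ t x * fderiv ℝ f x (v t x)) t := by
  obtain ⟨Ω, _, P, X, hP, hX, hlaw⟩ := hgen
  have hfc : Continuous (fderiv ℝ f) := hf.continuous_fderiv one_ne_zero
  have hgc : Continuous fun p : ℝ × E d => fderiv ℝ f p.2 (v p.1 p.2) :=
    (hfc.comp continuous_snd).clm_apply hv.continuous
  have hρm : ∀ s, Measurable (ρ s) := fun s => (hρ.contDiff s).continuous.measurable
  have hlaw_int : ∀ s ∈ Icc 0 T, ∀ g : E d → ℝ, Continuous g →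
      ∫ z, g (X s z) ∂P = ∫ x, ρ s x * g x := fun s hs g hg => by
    rw [← integral_densityMeasure (hρm s) (fun x => (hpos s hs x).le)]
    exact (hlaw s hs).integral_comp hg.aestronglyMeasurable
  obtain ⟨C, hC⟩ := ((isCompact_Icc (a := (0 : ℝ)) (b := T)).prod
    hfs.isCompact).exists_bound_of_continuousOn hgc.continuousOn
  have hC' : ∀ s ∈ Icc 0 T, ∀ x, ‖fderiv ℝ f x (v s x)‖ ≤ max C 0 := by
    intro s hs x
    by_cases hx : x ∈ tsupport f
    · exact (hC (s, x) ⟨hs, hx⟩).trans (le_max_left _ _)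
    · rw [fderiv_of_notMem_tsupport (𝕜 := ℝ) hx]
      simp
  have hnhds : Icc 0 T ∈ 𝓝 t := Icc_mem_nhds ht.1 ht.2
  have hmeas : ∀ s ∈ Icc 0 T, ∀ g : E d → ℝ, Continuous g →
      AEStronglyMeasurable (fun z => g (X s z)) P := fun s hs g hg =>
    (hg.measurable.comp_aemeasurable (hlaw s hs).aemeasurable).aestronglyMeasurable
  have htT : t ∈ Icc 0 T := Ioo_subset_Icc_self ht
  obtain ⟨Cf, hCf⟩ := hfs.exists_bound_of_continuous hf.continuous
  -- Differentiate E f(X_s) under the expectation by the chain rule; compact support of f gives a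
  -- constant dominating function.
  have key := (hasDerivAt_integral_of_dominated_loc_of_deriv_le (μ := P) (x₀ := t)
    (s := Ioo 0 T) (F := fun s z => f (X s z))
    (F' := fun s z => fderiv ℝ f (X s z) (v s (X s z))) (bound := fun _ => max C 0)
    (isOpen_Ioo.mem_nhds ht)
    (by filter_upwards [hnhds] with s hs using hmeas s hs f hf.continuous)
    (Integrable.of_bound (hmeas t htT f hf.continuous) Cf
      (Filter.Eventually.of_forall fun z => hCf _))
    (hmeas t htT (fun x => fderiv ℝ f x (v t x))
      (hgc.comp (continuous_const.prodMk continuous_id)))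
    (Filter.Eventually.of_forall fun z s hs => hC' s (Ioo_subset_Icc_self hs) _)
    (integrable_const _)
    (by
      filter_upwards [hX] with z hz s hs
      exact (hf.differentiable one_ne_zero (X s z)).hasFDerivAt.comp_hasDerivAt s
        ((hz s (Ioo_subset_Icc_self hs)).hasDerivAt (Icc_mem_nhds hs.1 hs.2)))).2
  rw [hlaw_int t htT (fun x => fderiv ℝ f x (v t x))
    (hgc.comp (continuous_const.prodMk continuous_id))] at key
  refine key.congr_of_eventuallyEq ?_
  filter_upwards [hnhds] with s hs using (hlaw_int s hs f hf.continuous).symm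

/-- The density of a generated probability path solves the continuity equation pointwise, in
integrated form. -/
theorem Generates.eq_sub_integral_divergence (hgen : Generates T v ρ) (hv : C1Space v)
    (hρ : C1Space ρ) (hpos : ∀ t ∈ Icc 0 T, ∀ x, 0 < ρ t x) {t : ℝ} (ht : t ∈ Icc 0 T)
    (x : E d) :
    ρ t x = ρ 0 x - ∫ s in (0 : ℝ)..t, divergence (fun y => ρ s y • v s y) x := by
  have hu : C1Space fun s y => ρ s y • v s y := hρ.smul hv
  have hD : Continuous fun p : ℝ × E d => divergence (fun y => ρ p.1 y • v p.1 y) p.2 :=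
    hu.continuous_divergence
  have hI : Continuous fun x => ∫ s in (0 : ℝ)..t, divergence (fun y => ρ s y • v s y) x :=
    intervalIntegral.continuous_parametric_intervalIntegral_of_continuous'
      (f := fun x s => divergence (fun y => ρ s y • v s y) x)
      (hD.comp continuous_swap) 0 t
  have hρt : ∀ s, Continuous (ρ s) := fun s => (hρ.contDiff s).continuous
  set h : E d → ℝ := fun x =>
    ρ t x - ρ 0 x + ∫ s in (0 : ℝ)..t, divergence (fun y => ρ s y • v s y) x with hh
  have hcont : Continuous h := ((hρt t).sub (hρt 0)).add hI
  -- Fundamental lemma of the calculus of variations: it suffices that h integrates to zero against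
  -- every smooth bump.
  have hzero : ∀ᵐ x ∂(volume : Measure (E d)), h x = 0 := by
    refine ae_eq_zero_of_integral_contDiff_smul_eq_zero hcont.locallyIntegrable
      fun f hf hfs => ?_
    have hf1 : ContDiff ℝ 1 f := hf.of_le (by exact_mod_cast le_top)
    have hint : ∀ g : E d → ℝ, Continuous g → Integrable fun x => f x * g x := fun g hg =>
      (hf.continuous.mul hg).integrable_of_hasCompactSupport hfs.mul_right
    have hderiv : ∀ s ∈ Ioo 0 t, HasDerivAt (fun s => ∫ x, ρ s x * f x)
        (- ∫ x, f x * divergence (fun y => ρ s y • v s y) x) s := by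
      intro s hs
      have hd := hgen.hasDerivAt_integral hv hρ hpos hf1 hfs
        (t := s) ⟨hs.1, hs.2.trans_le ht.2⟩
      refine hd.congr_deriv ?_
      rw [integral_mul_divergence volume hf1 hfs (hu.contDiff s), neg_neg]
      simp
    have hc1 : Continuous fun s => ∫ x, ρ s x * f x := by
      rw [← continuousOn_univ]
      refine continuousOn_integral_of_compact_support hfs.isCompact
        (hρ.continuous.mul (hf.continuous.comp continuous_snd)).continuousOn fun s x _ hx => ?_
      simp [image_eq_zero_of_notMem_tsupport hx]
    have hc2 : Continuous fun s => ∫ x, f x * divergence (fun y => ρ s y • v s y) x := by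
      rw [← continuousOn_univ]
      refine continuousOn_integral_of_compact_support hfs.isCompact
        ((hf.continuous.comp continuous_snd).mul hD).continuousOn fun s x _ hx => ?_
      simp [image_eq_zero_of_notMem_tsupport hx]
    have hftc := intervalIntegral.integral_eq_sub_of_hasDerivAt_of_le ht.1 hc1.continuousOn hderiv
      (hc2.neg.intervalIntegrable _ _)
    have hswap : ∫ s in (0 : ℝ)..t, ∫ x, f x * divergence (fun y => ρ s y • v s y) x
        = ∫ x, f x * ∫ s in (0 : ℝ)..t, divergence (fun y => ρ s y • v s y) x := by
      rw [intervalIntegral_integral_swap]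
      · simp only [intervalIntegral.integral_const_mul]
      · have hc : Continuous (Function.uncurry fun (s : ℝ) x =>
            f x * divergence (fun y => ρ s y • v s y) x) :=
          (hf.continuous.comp continuous_snd).mul hD
        have hon := hc.continuousOn.integrableOn_compact
          (μ := (volume : Measure ℝ).prod (volume : Measure (E d)))
          ((isCompact_uIcc (a := (0 : ℝ)) (b := t)).prod hfs.isCompact)
        have hon2 : IntegrableOn (Function.uncurry fun (s : ℝ) x =>
            f x * divergence (fun y => ρ s y • v s y) x) (uIcc 0 t ×ˢ univ)
            ((volume : Measure ℝ).prod (volume : Measure (E d))) := by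
          refine hon.of_forall_sdiff_eq_zero (measurableSet_uIcc.prod MeasurableSet.univ) ?_
          rintro ⟨s, x⟩ ⟨h1, h2⟩
          have hx : x ∉ tsupport f := fun hx => h2 ⟨h1.1, hx⟩
          simp [Function.uncurry, image_eq_zero_of_notMem_tsupport hx]
        have := hon2.mono_set (prod_mono_left (t := (univ : Set (E d))) uIoc_subset_uIcc)
        rwa [IntegrableOn, ← Measure.prod_restrict, Measure.restrict_univ] at this
    rw [intervalIntegral.integral_neg, hswap] at hftc
    have hsplit : ∫ x, f x • h x = (∫ x, f x * ρ t x) - (∫ x, f x * ρ 0 x)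
        + ∫ x, f x * ∫ s in (0 : ℝ)..t, divergence (fun y => ρ s y • v s y) x := by
      have hsub : Integrable fun x => f x * ρ t x - f x * ρ 0 x :=
        (hint _ (hρt t)).sub (hint _ (hρt 0))
      rw [← integral_sub (hint _ (hρt t)) (hint _ (hρt 0)), ← integral_add hsub (hint _ hI)]
      congr 1
      ext x
      simp only [hh, smul_eq_mul]
      ring
    rw [hsplit]
    simp only [mul_comm (ρ _ _) (f _)] at hftc
    linarith
  -- Continuity of h upgrades almost everywhere to everywhere.
  have hall := congrFun (Measure.eq_of_ae_eq (hzero : h =ᵐ[volume] fun _ => 0) hcont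
    continuous_const) x
  simp only [hh] at hall
  linarith

end ContinuityEquation

/-! ### The conserved quantity along trajectories of the mixed field -/

section AlongFlow

variable {d : ℕ} {T : ℝ}

/-- The derivative of the density of a generated path along an arbitrary differentiable curve. -/
lemma Generates.hasDerivAt_comp_curve {v : ℝ → E d → E d} {ρ : ℝ → E d → ℝ}
    (hgen : Generates T v ρ) (hv : C1Space v) (hρ : C1Space ρ)
    (hpos : ∀ t ∈ Icc 0 T, ∀ x, 0 < ρ t x) {y : ℝ → E d} {y' : E d} {t : ℝ} (ht : t ∈ Ioo 0 T)
    (hy : HasDerivAt y y' t) :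
    HasDerivAt (fun s => ρ s (y s))
      (fderiv ℝ (ρ t) (y t) y' - (ρ t (y t) * divergence (v t) (y t)
        + fderiv ℝ (ρ t) (y t) (v t (y t)))) t := by
  set D : ℝ → E d → ℝ := fun s x => divergence (fun y => ρ s y • v s y) x with hD
  have hDc : Continuous fun p : ℝ × E d => D p.1 p.2 := (hρ.smul hv).continuous_divergence
  have hDx : ∀ x, Continuous fun s => D s x := fun x =>
    hDc.comp (continuous_id.prodMk continuous_const)
  have htime : ∀ x, ∀ s ∈ Ioo 0 T, HasDerivAt (fun s => ρ s x) (-D s x) s := by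
    intro x s hs
    have h1 := ((hDx x).integral_hasStrictDerivAt 0 s).hasDerivAt.const_sub (ρ 0 x)
    refine h1.congr_of_eventuallyEq ?_
    filter_upwards [Icc_mem_nhds hs.1 hs.2] with r hr
    exact hgen.eq_sub_integral_divergence hv hρ hpos hr x
  -- Both partial derivatives of ρ are jointly continuous, so ρ is jointly differentiable in (t, x)
  -- and the chain rule applies.
  have hstrict := hasStrictFDerivAt_uncurry_coprod (𝕜 := ℝ) (u := (t, y t)) (f := ρ)
    (f₁ := fun s x => ContinuousLinearMap.toSpanSingleton ℝ (-D s x))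
    (f₂ := fun s x => fderiv ℝ (ρ s) x)
    (by
      have : ∀ᶠ p : ℝ × E d in 𝓝 (t, y t), p.1 ∈ Ioo 0 T :=
        continuous_fst.continuousAt.eventually_mem (isOpen_Ioo.mem_nhds ht)
      filter_upwards [this] with p hp
      exact (htime p.2 p.1 hp).hasFDerivAt)
    (Filter.Eventually.of_forall fun p => (hρ.differentiable p.1 p.2).hasFDerivAt)
    ((ContinuousLinearMap.toSpanSingletonCLE (𝕜 := ℝ) (E := ℝ)).continuous.comp
      hDc.neg).continuousAt
    hρ.continuous_fderiv.continuousAt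
  have h := hstrict.hasFDerivAt.comp_hasDerivAt_of_eq t ((hasDerivAt_id t).prodMk hy) rfl
  refine h.congr_deriv ?_
  have hDt : D t (y t) = ρ t (y t) * divergence (v t) (y t) + fderiv ℝ (ρ t) (y t) (v t (y t)) :=
    divergence_smul (hρ.differentiable t _) (hv.differentiable t _)
  rw [← hDt]
  simp [Function.HasUncurry.uncurry]
  ring

lemma C1Space.mixedField {v₁ v₂ : ℝ → E d → E d} (hv₁ : C1Space v₁) (hv₂ : C1Space v₂) (γ : ℝ) :
    C1Space (mixedField γ v₁ v₂) where
  continuous := (hv₁.continuous.const_smul γ).add (hv₂.continuous.const_smul (1 - γ))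
  differentiable t :=
    ((hv₁.differentiable t).const_smul γ).add ((hv₂.differentiable t).const_smul (1 - γ))
  continuous_fderiv := by
    have h : (fun p : ℝ × E d => fderiv ℝ (FlowGuidance.mixedField γ v₁ v₂ p.1) p.2)
        = fun p => γ • fderiv ℝ (v₁ p.1) p.2 + (1 - γ) • fderiv ℝ (v₂ p.1) p.2 := by
      funext p
      exact (((hv₁.differentiable p.1 p.2).hasFDerivAt.const_smul γ).add
        ((hv₂.differentiable p.1 p.2).hasFDerivAt.const_smul (1 - γ))).fderiv
    rw [h]
    exact (hv₁.continuous_fderiv.const_smul γ).add (hv₂.continuous_fderiv.const_smul (1 - γ))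

lemma divergence_mixedField {v₁ v₂ : ℝ → E d → E d} (hv₁ : C1Space v₁) (hv₂ : C1Space v₂)
    (γ t : ℝ) (x : E d) : divergence (mixedField γ v₁ v₂ t) x
      = γ * divergence (v₁ t) x + (1 - γ) * divergence (v₂ t) x := by
  have h := (((hv₁.differentiable t x).hasFDerivAt.const_smul γ).add
    ((hv₂.differentiable t x).hasFDerivAt.const_smul (1 - γ))).fderiv
  change traceCLM _ (fderiv ℝ (γ • v₁ t + (1 - γ) • v₂ t) x) = _
  rw [h, map_add, map_smul, map_smul]
  rfl

lemma inner_gradient_log {f : E d → ℝ} {x : E d} (hf : DifferentiableAt ℝ f x) (h : f x ≠ 0)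
    (u : E d) : inner ℝ u (gradient (fun y => Real.log (f y)) x) = (f x)⁻¹ * fderiv ℝ f x u := by
  rw [gradient, real_inner_comm, InnerProductSpace.toDual_symm_apply, (hf.hasFDerivAt.log h).fderiv]
  simp

/-- The weighted flow transports the initial density to the unnormalized mixture, for fields
defined at all times. -/
theorem unnormalizedMixture_flow_mul_det_of_c1Space {γ : ℝ} {v₁ v₂ : ℝ → E d → E d}
    {ρ₁ ρ₂ : ℝ → E d → ℝ} {ψ : ℝ → E d → E d}
    (hv₁ : C1Space v₁) (hv₂ : C1Space v₂) (hρ₁ : C1Space ρ₁) (hρ₂ : C1Space ρ₂)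
    (hpos₁ : ∀ t ∈ Icc 0 T, ∀ x, 0 < ρ₁ t x) (hpos₂ : ∀ t ∈ Icc 0 T, ∀ x, 0 < ρ₂ t x)
    (hstart : ρ₁ 0 = ρ₂ 0)
    (hgen₁ : Generates T v₁ ρ₁) (hgen₂ : Generates T v₂ ρ₂) {x : E d}
    (h0 : ψ 0 x = x) (hψ : IsIntegralCurveOn (fun t => ψ t x) (mixedField γ v₁ v₂) (Icc 0 T))
    {J : ℝ → E d →L[ℝ] E d} (hJ0 : J 0 = ContinuousLinearMap.id ℝ (E d))
    (hJ : ∀ t ∈ Icc 0 T, HasDerivWithinAt J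
      ((fderiv ℝ (mixedField γ v₁ v₂ t) (ψ t x)).comp (J t)) (Icc 0 T) t)
    {t : ℝ} (ht : t ∈ Icc 0 T) :
    unnormalizedMixture γ ρ₁ ρ₂ t (ψ t x) * (J t).det
      = ρ₁ 0 x * Real.exp (weight γ v₁ v₂ ρ₁ ρ₂ ψ t x) := by
  have hsub : Icc 0 t ⊆ Icc 0 T := Icc_subset_Icc_right ht.2
  have hψc : ContinuousOn (fun s => ψ s x) (Icc 0 t) := hψ.continuousOn.mono hsub
  have hcomp : ∀ {F : Type} [TopologicalSpace F] {f : ℝ × E d → F}, Continuous f →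
      ContinuousOn (fun s => f (s, ψ s x)) (Icc 0 t) := fun hf =>
    hf.comp_continuousOn (continuousOn_id.prodMk hψc)
  have hρ₁c := hcomp hρ₁.continuous
  have hρ₂c := hcomp hρ₂.continuous
  have hp₁ : ∀ s ∈ Icc 0 t, 0 < ρ₁ s (ψ s x) := fun s hs => hpos₁ s (hsub hs) _
  have hp₂ : ∀ s ∈ Icc 0 t, 0 < ρ₂ s (ψ s x) := fun s hs => hpos₂ s (hsub hs) _
  set k : ℝ → ℝ := fun s => inner ℝ (v₁ s (ψ s x) - v₂ s (ψ s x))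
      (gradient (fun y => Real.log (ρ₁ s y)) (ψ s x)
        - gradient (fun y => Real.log (ρ₂ s y)) (ψ s x)) with hk
  have hkeq : ∀ s ∈ Icc 0 t, k s =
      (ρ₁ s (ψ s x))⁻¹ * fderiv ℝ (ρ₁ s) (ψ s x) (v₁ s (ψ s x) - v₂ s (ψ s x))
      - (ρ₂ s (ψ s x))⁻¹ * fderiv ℝ (ρ₂ s) (ψ s x) (v₁ s (ψ s x) - v₂ s (ψ s x)) := by
    intro s hs
    simp only [hk]
    rw [inner_sub_right, inner_gradient_log (hρ₁.differentiable s _) (hp₁ s hs).ne',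
      inner_gradient_log (hρ₂.differentiable s _) (hp₂ s hs).ne']
  have hdiffc := hcomp (hv₁.continuous.sub hv₂.continuous)
  have hkc : ContinuousOn k (Icc 0 t) := by
    refine ContinuousOn.congr ?_ hkeq
    exact ((hρ₁c.inv₀ fun s hs => (hp₁ s hs).ne').mul
        ((hcomp hρ₁.continuous_fderiv).clm_apply hdiffc)).sub
      ((hρ₂c.inv₀ fun s hs => (hp₂ s hs).ne').mul
        ((hcomp hρ₂.continuous_fderiv).clm_apply hdiffc))
  set W : ℝ → ℝ := fun s => ∫ r in (0 : ℝ)..s, k r with hW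
  have hWc : ContinuousOn W (Icc 0 t) := by
    have := intervalIntegral.continuousOn_primitive_interval (μ := volume) (f := k) (a := 0)
      (b := t) (by rw [uIcc_of_le ht.1]; exact hkc.integrableOn_Icc)
    rwa [uIcc_of_le ht.1] at this
  have hWd : ∀ s ∈ Ioo 0 t, HasDerivAt W (k s) s := fun s hs =>
    intervalIntegral.integral_hasDerivAt_right
      ((hkc.mono (Icc_subset_Icc_right hs.2.le)).intervalIntegrable_of_Icc hs.1.le)
      ((hkc.mono Ioo_subset_Icc_self).stronglyMeasurableAtFilter isOpen_Ioo s hs)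
      (hkc.continuousAt (Icc_mem_nhds hs.1 hs.2))
  have hdetd : ∀ s ∈ Icc 0 T, HasDerivWithinAt (fun s => (J s).det)
      (divergence (mixedField γ v₁ v₂ s) (ψ s x) * (J s).det) (Icc 0 T) s :=
    fun s hs => hasDerivWithinAt_det (hJ s hs)
  set c : ℝ := γ * (γ - 1) with hc
  -- The conserved quantity. Keeping det J as a factor, rather than its logarithm, requires no
  -- knowledge of its sign.
  set g : ℝ → ℝ := fun s => ρ₁ s (ψ s x) ^ γ * ρ₂ s (ψ s x) ^ (1 - γ) * (J s).det
    * Real.exp (-(c * W s)) with hg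
  have hgc : ContinuousOn g (Icc 0 t) :=
    (((hρ₁c.rpow_const fun s hs => Or.inl (hp₁ s hs).ne').mul
      (hρ₂c.rpow_const fun s hs => Or.inl (hp₂ s hs).ne')).mul
      fun s hs => (hdetd s (hsub hs)).continuousWithinAt.mono hsub).mul
      (Real.continuous_exp.comp_continuousOn (hWc.const_smul c).neg)
  have hgd : ∀ s ∈ Ioo 0 t, HasDerivAt g 0 s := by
    intro s hs
    have hs' : s ∈ Icc 0 t := Ioo_subset_Icc_self hs
    have hsT : s ∈ Ioo 0 T := ⟨hs.1, hs.2.trans_le ht.2⟩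
    have hnhds : Icc 0 T ∈ 𝓝 s := Icc_mem_nhds hsT.1 hsT.2
    have hy := (hψ s (hsub hs')).hasDerivAt hnhds
    have h1 := (hgen₁.hasDerivAt_comp_curve hv₁ hρ₁ hpos₁ hsT hy).rpow_const (p := γ)
      (Or.inl (hp₁ s hs').ne')
    have h2 := (hgen₂.hasDerivAt_comp_curve hv₂ hρ₂ hpos₂ hsT hy).rpow_const (p := 1 - γ)
      (Or.inl (hp₂ s hs').ne')
    have h3 := (hdetd s (hsub hs')).hasDerivAt hnhds
    have h4 := ((hWd s hs).const_mul c).fun_neg.exp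
    refine (((h1.fun_mul h2).fun_mul h3).fun_mul h4).congr_deriv ?_
    rw [hkeq s hs', divergence_mixedField hv₁ hv₂, Real.rpow_sub_one (hp₁ s hs').ne',
      Real.rpow_sub_one (hp₂ s hs').ne', hc]
    have hne₁ := (hp₁ s hs').ne'
    have hne₂ := (hp₂ s hs').ne'
    simp only [mixedField, map_add, map_sub, map_smul, smul_eq_mul]
    field_simp
    ring
  have hconst := intervalIntegral.integral_eq_sub_of_hasDerivAt_of_le ht.1 hgc hgd
    (continuous_const.intervalIntegrable (μ := volume) _ _)
  rw [intervalIntegral.integral_zero] at hconst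
  -- The two densities agree at time 0 and the exponents add up to 1.
  have hg0 : g 0 = ρ₁ 0 x := by
    have hx : 0 < ρ₁ 0 x := hpos₁ 0 ⟨le_rfl, ht.1.trans ht.2⟩ x
    have hdet1 : (J 0).det = 1 := by rw [hJ0]; exact LinearMap.det_id
    simp only [hg, h0, hW, hdet1, ← hstart, intervalIntegral.integral_same]
    rw [← Real.rpow_add hx]
    simp
  have hgt : g t = ρ₁ 0 x := by linarith
  have hw : weight γ v₁ v₂ ρ₁ ρ₂ ψ t x = c * W t := rfl
  rw [hw, ← hgt]
  simp only [hg, unnormalizedMixture]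
  rw [mul_assoc _ (Real.exp _), ← Real.exp_add]
  simp

end AlongFlow

/-! ### Reduction to fields defined at all times -/

section Clamp

/-- The time `t` projected to `[0, T]`. -/
def clampTime (T t : ℝ) : ℝ := max 0 (min T t)

lemma clampTime_of_mem {T t : ℝ} (ht : t ∈ Icc 0 T) : clampTime T t = t := by
  rw [clampTime, min_eq_right ht.2, max_eq_right ht.1]

lemma clampTime_mem {T : ℝ} (hT : 0 ≤ T) (t : ℝ) : clampTime T t ∈ Icc 0 T :=
  ⟨le_max_left _ _, max_le hT (min_le_left _ _)⟩

variable {d : ℕ} {T : ℝ}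

/-- Freezing time outside [0, T] turns regularity on the slab into global regularity without
changing anything on [0, T]. -/
lemma IsC1InSpace.c1Space {F : Type*} [NormedAddCommGroup F] [NormedSpace ℝ F]
    {f : ℝ → E d → F} (hT : 0 ≤ T) (hf : IsC1InSpace T f) :
    C1Space fun t => f (clampTime T t) := by
  have hc : Continuous fun p : ℝ × E d => (clampTime T p.1, p.2) := by
    unfold clampTime; fun_prop
  have hm : ∀ p : ℝ × E d, (clampTime T p.1, p.2) ∈ Icc 0 T ×ˢ (univ : Set (E d)) := fun p =>
    ⟨clampTime_mem hT _, mem_univ _⟩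
  exact ⟨hf.continuousOn.comp_continuous hc hm,
    fun t => hf.differentiable _ (clampTime_mem hT t),
    hf.continuousOn_fderiv.comp_continuous hc hm⟩

lemma isIntegralCurveOn_clampTime {v : ℝ → E d → E d} {y : ℝ → E d}
    (hy : IsIntegralCurveOn y v (Icc 0 T)) :
    IsIntegralCurveOn y (fun t => v (clampTime T t)) (Icc 0 T) := fun t ht => by
  simpa only [clampTime_of_mem ht] using hy t ht

lemma Generates.clampTime {v : ℝ → E d → E d} {ρ : ℝ → E d → ℝ} (h : Generates T v ρ) :
    Generates T (fun t => v (clampTime T t)) (fun t => ρ (clampTime T t)) := by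
  obtain ⟨Ω, mΩ, P, X, hP, hX, hlaw⟩ := h
  refine ⟨Ω, mΩ, P, X, hP, hX.mono fun _ h => isIntegralCurveOn_clampTime h, fun t ht => ?_⟩
  simpa only [clampTime_of_mem ht] using hlaw t ht

end Clamp

/-! ### The transport identity for the original fields -/

section Mixture

variable {d : ℕ} {T γ : ℝ} {v₁ v₂ : ℝ → E d → E d} {ρ₁ ρ₂ : ℝ → E d → ℝ} {ψ : ℝ → E d → E d}

/-- The flow of the mixed field is a differentiable bijection, and the weighted flow transports
the initial density to the unnormalized mixture. -/
theorem IsFlow.exists_hasFDerivAt_unnormalizedMixture (hT : 0 ≤ T)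
    (hv₁ : IsC1InSpace T v₁) (hv₂ : IsC1InSpace T v₂)
    (hρ₁ : IsC1InSpace T ρ₁) (hρ₂ : IsC1InSpace T ρ₂)
    (hpos₁ : ∀ t ∈ Icc 0 T, ∀ x, 0 < ρ₁ t x) (hpos₂ : ∀ t ∈ Icc 0 T, ∀ x, 0 < ρ₂ t x)
    (hstart : ρ₁ 0 = ρ₂ 0) (hgen₁ : Generates T v₁ ρ₁) (hgen₂ : Generates T v₂ ρ₂)
    (hψ : IsFlow T (mixedField γ v₁ v₂) ψ) {t : ℝ} (ht : t ∈ Icc 0 T) :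
    Function.Bijective (ψ t) ∧ ∃ D : E d → E d →L[ℝ] E d, (∀ x, HasFDerivAt (ψ t) (D x) x) ∧
      ∀ x, unnormalizedMixture γ ρ₁ ρ₂ t (ψ t x) * (D x).det
        = ρ₁ 0 x * Real.exp (weight γ v₁ v₂ ρ₁ ρ₂ ψ t x) := by
  have h0 : (0 : ℝ) ∈ Icc 0 T := ⟨le_rfl, hT⟩
  have hv₁' := hv₁.c1Space hT
  have hv₂' := hv₂.c1Space hT
  have hu := hv₁'.mixedField hv₂' γ
  have hode : ∀ x, IsIntegralCurveOn (fun t => ψ t x)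
      (mixedField γ (fun t => v₁ (clampTime T t)) fun t => v₂ (clampTime T t)) (Icc 0 T) :=
    fun x => isIntegralCurveOn_clampTime (hψ.ode x)
  refine ⟨⟨fun x y hxy => ?_, hψ.surjective t ht⟩, ?_⟩
  · have := (hode x).eq_initial_of_eq hu (hode y) ht hxy
    simpa only [hψ.initial] using this
  choose J hJ0 hJ hJf using exists_hasFDerivAt_flow hu hT hψ.initial hode
  refine ⟨fun x => J x t, fun x => hJf x t ht, fun x => ?_⟩
  have key := unnormalizedMixture_flow_mul_det_of_c1Space hv₁' hv₂' (hρ₁.c1Space hT)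
    (hρ₂.c1Space hT) (fun s _ => hpos₁ _ (clampTime_mem hT s))
    (fun s _ => hpos₂ _ (clampTime_mem hT s)) (by simp only [clampTime_of_mem h0, hstart])
    hgen₁.clampTime hgen₂.clampTime (hψ.initial x) (hode x) (hJ0 x) (hJ x) ht
  have hw : weight γ (fun t => v₁ (clampTime T t)) (fun t => v₂ (clampTime T t))
      (fun t => ρ₁ (clampTime T t)) (fun t => ρ₂ (clampTime T t)) ψ t x
      = weight γ v₁ v₂ ρ₁ ρ₂ ψ t x := by
    unfold weight
    congr 1
    refine intervalIntegral.integral_congr fun s hs => ?_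
    rw [uIcc_of_le ht.1] at hs
    simp only [clampTime_of_mem ⟨hs.1, hs.2.trans ht.2⟩]
  rw [hw] at key
  simpa only [unnormalizedMixture, clampTime_of_mem ht, clampTime_of_mem h0] using key

end Mixture

end FlowGuidance

end

/-! ### Change of variables and normalization -/

theorem proposition3 (d : ℕ) (T : ℝ) (hT : 0 < T) (γ : ℝ)
    (v₁ v₂ : ℝ → FlowGuidance.E d → FlowGuidance.E d)
    (ρ₀ : FlowGuidance.E d → ℝ) (ρ₁ ρ₂ : ℝ → FlowGuidance.E d → ℝ)
    (ψ : ℝ → FlowGuidance.E d → FlowGuidance.E d)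
    (hv₁ : FlowGuidance.IsC1InSpace T v₁) (hv₂ : FlowGuidance.IsC1InSpace T v₂)
    (hρ₁ : FlowGuidance.IsC1InSpace T ρ₁) (hρ₂ : FlowGuidance.IsC1InSpace T ρ₂)
    (hpos₁ : ∀ t ∈ Set.Icc (0 : ℝ) T, ∀ x, 0 < ρ₁ t x)
    (hpos₂ : ∀ t ∈ Set.Icc (0 : ℝ) T, ∀ x, 0 < ρ₂ t x)
    (hstart₁ : ρ₁ 0 = ρ₀) (hstart₂ : ρ₂ 0 = ρ₀)
    (hgen₁ : FlowGuidance.Generates T v₁ ρ₁) (hgen₂ : FlowGuidance.Generates T v₂ ρ₂)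
    (hψ : FlowGuidance.IsFlow T (FlowGuidance.mixedField γ v₁ v₂) ψ)
    (t : ℝ) (ht : t ∈ Set.Icc (0 : ℝ) T)
    (hZ : MeasureTheory.Integrable (FlowGuidance.unnormalizedMixture γ ρ₁ ρ₂ t)) :
    MeasureTheory.IsProbabilityMeasure (FlowGuidance.geometricMixture γ ρ₁ ρ₂ t) ∧
    MeasureTheory.Integrable (fun x => Real.exp (FlowGuidance.weight γ v₁ v₂ ρ₁ ρ₂ ψ t x))
      (FlowGuidance.densityMeasure ρ₀) ∧
    0 < ∫ x, Real.exp (FlowGuidance.weight γ v₁ v₂ ρ₁ ρ₂ ψ t x)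
      ∂(FlowGuidance.densityMeasure ρ₀) ∧
    ∀ φ : FlowGuidance.E d → ℝ,
      MeasureTheory.Integrable φ (FlowGuidance.geometricMixture γ ρ₁ ρ₂ t) →
      MeasureTheory.Integrable
        (fun x => Real.exp (FlowGuidance.weight γ v₁ v₂ ρ₁ ρ₂ ψ t x) * φ (ψ t x))
        (FlowGuidance.densityMeasure ρ₀) ∧
      ∫ x, φ x ∂(FlowGuidance.geometricMixture γ ρ₁ ρ₂ t) =
        (∫ x, Real.exp (FlowGuidance.weight γ v₁ v₂ ρ₁ ρ₂ ψ t x) * φ (ψ t x)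
          ∂(FlowGuidance.densityMeasure ρ₀)) /
        (∫ x, Real.exp (FlowGuidance.weight γ v₁ v₂ ρ₁ ρ₂ ψ t x)
          ∂(FlowGuidance.densityMeasure ρ₀)) := by
  have h0 : (0 : ℝ) ∈ Set.Icc 0 T := ⟨le_rfl, hT.le⟩
  obtain ⟨hbij, D, hD, hkey⟩ := hψ.exists_hasFDerivAt_unnormalizedMixture hT.le hv₁ hv₂ hρ₁ hρ₂
    hpos₁ hpos₂ (hstart₁.trans hstart₂.symm) hgen₁ hgen₂ ht
  set q : FlowGuidance.E d → ℝ := FlowGuidance.unnormalizedMixture γ ρ₁ ρ₂ t with hq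
  set w : FlowGuidance.E d → ℝ := FlowGuidance.weight γ v₁ v₂ ρ₁ ρ₂ ψ t with hw
  rw [hstart₁] at hkey
  have hq0 : ∀ x, 0 < q x := fun x =>
    mul_pos (Real.rpow_pos_of_pos (hpos₁ t ht x) _) (Real.rpow_pos_of_pos (hpos₂ t ht x) _)
  have hqc : Continuous q :=
    ((hρ₁.differentiable t ht).continuous.rpow_const fun x => Or.inl (hpos₁ t ht x).ne').mul
      ((hρ₂.differentiable t ht).continuous.rpow_const fun x => Or.inl (hpos₂ t ht x).ne')
  have hρ₀m : Measurable ρ₀ := hstart₁ ▸ (hρ₁.differentiable 0 h0).continuous.measurable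
  have hρ₀ : ∀ x, 0 < ρ₀ x := hstart₁ ▸ hpos₁ 0 h0
  -- Positivity of the Jacobian is read off the transport identity, whose other factors are
  -- positive.
  have hdet : ∀ x, 0 < (D x).det := fun x => by
    have h := hkey x
    have : 0 < ρ₀ x * Real.exp (w x) := mul_pos (hρ₀ x) (Real.exp_pos _)
    rw [← h] at this
    exact pos_of_mul_pos_right this (hq0 _).le
  have hkey' : ∀ (φ : FlowGuidance.E d → ℝ) (x : FlowGuidance.E d),
      |(D x).det| • (q (ψ t x) * φ (ψ t x)) = ρ₀ x * (Real.exp (w x) * φ (ψ t x)) := by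
    intro φ x
    rw [abs_of_pos (hdet x), smul_eq_mul, ← mul_assoc, ← mul_assoc, ← hkey x, mul_comm (q _)]
  have himage : ψ t '' Set.univ = Set.univ := Set.image_univ_of_surjective hbij.2
  have hint : ∀ φ : FlowGuidance.E d → ℝ, MeasureTheory.Integrable (fun x => q x * φ x) ↔
      MeasureTheory.Integrable (fun x => Real.exp (w x) * φ (ψ t x))
        (FlowGuidance.densityMeasure ρ₀) := by
    intro φ
    -- This change of variables needs only injectivity and pointwise differentiability of ψ_t;
    -- surjectivity makes the image the whole space.
    have h := MeasureTheory.integrableOn_image_iff_integrableOn_abs_det_fderiv_smul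
      MeasureTheory.volume MeasurableSet.univ (fun x _ => (hD x).hasFDerivWithinAt)
      hbij.1.injOn (fun x => q x * φ x)
    rw [himage, MeasureTheory.integrableOn_univ, MeasureTheory.integrableOn_univ] at h
    rw [h, FlowGuidance.integrable_densityMeasure_iff hρ₀m fun x => (hρ₀ x).le]
    simp only [hkey']
  have hval : ∀ φ : FlowGuidance.E d → ℝ, ∫ x, q x * φ x =
      ∫ x, Real.exp (w x) * φ (ψ t x) ∂(FlowGuidance.densityMeasure ρ₀) := by
    intro φ
    have h := MeasureTheory.integral_image_eq_integral_abs_det_fderiv_smul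
      MeasureTheory.volume MeasurableSet.univ (fun x _ => (hD x).hasFDerivWithinAt)
      hbij.1.injOn (fun x => q x * φ x)
    rw [himage, MeasureTheory.setIntegral_univ, MeasureTheory.setIntegral_univ] at h
    rw [h, FlowGuidance.integral_densityMeasure hρ₀m fun x => (hρ₀ x).le]
    simp only [hkey']
  have hZpos : 0 < FlowGuidance.mixtureConst γ ρ₁ ρ₂ t :=
    MeasureTheory.integral_pos_of_integrable_nonneg_nonzero (x := 0) hqc hZ
      (fun x => (hq0 x).le) (hq0 0).ne'
  set Z := FlowGuidance.mixtureConst γ ρ₁ ρ₂ t with hZdef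
  have hqm : Measurable fun x => q x / Z := hqc.measurable.div_const Z
  have hqn : ∀ x, 0 ≤ q x / Z := fun x => div_nonneg (hq0 x).le hZpos.le
  have hZval : Z = ∫ x, Real.exp (w x) ∂(FlowGuidance.densityMeasure ρ₀) := by
    have h := hval fun _ => 1
    simp only [mul_one] at h
    exact h
  refine ⟨⟨?_⟩, ?_, hZval ▸ hZpos, fun φ hφ => ⟨?_, ?_⟩⟩
  · have hlin : ∫⁻ x, ENNReal.ofReal (q x / Z) = ENNReal.ofReal (∫ x, q x / Z) :=
      (MeasureTheory.ofReal_integral_eq_lintegral_ofReal (hZ.div_const Z)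
        (Filter.Eventually.of_forall hqn)).symm
    have hone : ∫ x, q x / Z = 1 := by
      rw [MeasureTheory.integral_div]
      exact div_self hZpos.ne'
    rw [FlowGuidance.geometricMixture, FlowGuidance.densityMeasure,
      MeasureTheory.withDensity_apply _ MeasurableSet.univ, MeasureTheory.Measure.restrict_univ,
      hlin, hone, ENNReal.ofReal_one]
  · have h := (hint fun _ => 1).1 (by simpa only [mul_one] using hZ)
    simpa only [mul_one] using h
  · rw [FlowGuidance.geometricMixture, FlowGuidance.integrable_densityMeasure_iff hqm hqn] at hφ
    refine (hint φ).1 ((hφ.const_mul Z).congr (Filter.Eventually.of_forall fun x => ?_))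
    simp only
    field_simp
  · rw [FlowGuidance.geometricMixture, FlowGuidance.integral_densityMeasure hqm hqn, ← hZval,
      ← hval, ← MeasureTheory.integral_div]
    simp only [div_mul_eq_mul_div]
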